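/- A structure $M$ in a finite language $L$ is resplendent if for every finite language $L^*\supseteq L$, every recursive set $T(w_1,\dots,w_k)$ of $L^*$-formulas in the free variables $w_1,\dots,w_k$, and every $a\in M^k$ such that $T(a)\cup\mathrm{Th}(M,a)$ is consistent, there is an expansion $M^*$ of $M$ to an $L^*$-structure with $(M^*,a)\models T(w)$. For a convex subring $O$ of an ordered field $K$ (convex: $x\le z\le y$ and $x,y\in O$ imply $z\in O$; such an $O$ is a valuation ring), let $k_O$ be the residue field of $O$ with the ordering induced from $K$, and let $v_O\colon K^\times\to\Gamma_O=K^\times/O^\times$ be the associated valuation, where $\Gamma_O$ is written additively and ordered by $v_O(x)\le v_O(y)\iff y/x\in O$. The standard value group of $K$ is $\Gamma=\Gamma_{\mathrm{Fin}}$, where $\mathrm{Fin}=\{x\in K: |x|\le n\text{ for some }n\in\mathbb N\}$. **Proposition.** Let $K$ be a real closed field that is resplendent as a structure in the language of ordered rings. Then there is a convex subring $O$ of $K$ such that $|k_O|=|K|$ and $(k_O,+,<)\cong\Gamma_O$ as ordered groups. In particular, the standard value group $\Gamma$ of $K$ has bounded intervals of cardinality $|K|$, i.e. there are $a,b\in\Gamma$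 such that $\{g\in\Gamma: a\le g\le b\}$ has cardinality $|K|$. -/

import Mathlib

universe u

/-! ### Recursive sets of formulas -/

namespace FirstOrder.Language

/-- The Gödel number of a term in the free variables `w₀, …, w_{k-1}` and the bound variables
`x₀, …, x_{n-1}`, relative to a numbering `c` of the symbols of the language. -/
def termCode {L : Language.{0, 0}} (c : L.Symbols → ℕ) {k n : ℕ} :
    L.Term (Fin k ⊕ Fin n) → ℕ
  | .var (.inl i) => Nat.pair 0 i
  | .var (.inr i) => Nat.pair 1 i
  | .func f ts => Nat.pair 2 (Nat.pair (c (Sum.inl ⟨_, f⟩))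
      (Encodable.encode (List.ofFn fun i => termCode c (ts i))))

/-- The Gödel number of a formula in the free variables `w₀, …, w_{k-1}`, relative to a numbering
`c` of the symbols of the language. -/
def formulaCode {L : Language.{0, 0}} (c : L.Symbols → ℕ) {k : ℕ} :
    {n : ℕ} → L.BoundedFormula (Fin k) n → ℕ
  | _, .falsum => Nat.pair 0 0
  | _, .equal s t => Nat.pair 1 (Nat.pair (termCode c s) (termCode c t))
  | _, .rel R ts => Nat.pair 2 (Nat.pair (c (Sum.inr ⟨_, R⟩))
      (Encodable.encode (List.ofFn fun i => termCode c (ts i))))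
  | _, .imp φ ψ => Nat.pair 3 (Nat.pair (formulaCode c φ) (formulaCode c ψ))
  | _, .all φ => Nat.pair 4 (formulaCode c φ)

/-- A set of formulas of a finite language in the free variables `w₀, …, w_{k-1}` is *recursive*
if its set of Gödel numbers is a computable set of natural numbers. As the language is finite, any
two numberings of its symbols differ by a computable function, so that the choice of the numbering
is immaterial. -/
def IsRecursive {L : Language.{0, 0}} {k : ℕ} (T : Set (L.Formula (Fin k))) : Prop :=
  ∃ c : L.Symbols → ℕ, Function.Injective c ∧
    ComputablePred fun m : ℕ => ∃ φ ∈ T, formulaCode c φ = m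

/-- `L.pointTheory L' a` is `Th(M, a)`: the set of all formulas `φ(w)` of `L` with `M ⊨ φ(a)`,
regarded as formulas of the larger language `L.sum L'`. -/
def pointTheory (L L' : Language.{0, 0}) {M : Type u} [L.Structure M] {k : ℕ} (a : Fin k → M) :
    Set ((L.sum L').Formula (Fin k)) :=
  (LHom.sumInl : L →ᴸ L.sum L').onFormula '' {φ | φ.Realize a}

/-- A structure `M` in a finite language `L` is *resplendent* if for all finite languages
`L* = L.sum L'` extending `L`, all recursive `L*`-theories `T(w)` in finitely many free variables
`w`, and all tuples `a` from `M`, if `T(a) ∪ Th(M, a)` is consistent, then `M` has an expansion to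
an `L*`-structure that satisfies `T(a)`. For consistency the variables `w` are replaced by new
constant symbols. -/
def IsResplendent (L : Language.{0, 0}) [Finite L.Symbols] (M : Type u) [L.Structure M] : Prop :=
  ∀ (L' : Language.{0, 0}) [Finite L'.Symbols] (k : ℕ) (T : Set ((L.sum L').Formula (Fin k)))
    (a : Fin k → M), IsRecursive T →
    Theory.IsSatisfiable (Formula.equivSentence '' (T ∪ L.pointTheory L' a)) →
    ∃ _ : L'.Structure M, ∀ φ ∈ T, φ.Realize a

/-- The language `{+, ·, -, 0, 1, ≤}` of ordered rings. -/
protected abbrev orderedRing : Language.{0, 0} := Language.ring.sum Language.order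

instance finite_symbols_orderedRing : Finite Language.orderedRing.Symbols := by
  refine Cardinal.mk_lt_aleph0_iff.1 ?_
  change Language.orderedRing.card < _
  rw [card_sum]
  simp only [Ring.card_ring, order.card_eq_one, Cardinal.lift_id]
  exact_mod_cast Cardinal.natCast_lt_aleph0 (n := 6)

/-- An ordered field as a structure in the language of ordered rings. -/
abbrev orderedRingStructure (K : Type u) [Field K] [LinearOrder K] :
    Language.orderedRing.Structure K :=
  letI : Language.ring.Structure K := (Ring.compatibleRingOfRing K).toStructure
  letI : Language.order.Structure K := orderStructure K
  sumStructure Language.ring Language.order K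

end FirstOrder.Language

/-- An ordered field is resplendent if it is so as a structure in the language of ordered rings. -/
def IsResplendentField (K : Type u) [Field K] [LinearOrder K] : Prop :=
  letI := FirstOrder.Language.orderedRingStructure K
  FirstOrder.Language.IsResplendent FirstOrder.Language.orderedRing K

/-! ### Convex subrings, their residue fields and value groups -/

/-- A convex subring of an ordered field. -/
structure ConvexSubring (K : Type u) [Field K] [LinearOrder K] extends Subring K where
  ordConnected' : Set.OrdConnected carrier

namespace ConvexSubring

variable {K : Type u} [Field K] [LinearOrder K] [IsStrictOrderedRing K]

/-- A convex subring of an ordered field is a valuation ring. -/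
def toValuationSubring (O : ConvexSubring K) : ValuationSubring K where
  toSubring := O.toSubring
  mem_or_inv_mem' x := by
    have key : ∀ y : K, |y| ≤ 1 → y ∈ O.carrier := fun y hy =>
      O.ordConnected'.out (O.toSubring.neg_mem O.toSubring.one_mem) O.toSubring.one_mem
        (abs_le.1 hy)
    rcases le_total |x| 1 with h | h
    · exact Or.inl (key x h)
    · exact Or.inr (key _ (by rw [abs_inv]; exact inv_le_one_of_one_le₀ h))

/-- The residue field `k_O` of a convex subring. -/
def ResidueField (O : ConvexSubring K) : Type u :=
  IsLocalRing.ResidueField O.toValuationSubring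

noncomputable instance (O : ConvexSubring K) : Field O.ResidueField :=
  inferInstanceAs (Field (IsLocalRing.ResidueField O.toValuationSubring))

/-- The residue map `O → k_O`. -/
noncomputable def residue (O : ConvexSubring K) : O.toValuationSubring →+* O.ResidueField :=
  IsLocalRing.residue O.toValuationSubring

theorem residue_surjective (O : ConvexSubring K) : Function.Surjective O.residue :=
  IsLocalRing.residue_surjective

/-- Elements between `0` and a nonunit of `O` are nonunits of `O`. -/
theorem mem_maximalIdeal_of_le (O : ConvexSubring K) {x y : O.toValuationSubring} (hx : 0 ≤ x)
    (hxy : x ≤ y) (hy : y ∈ IsLocalRing.maximalIdeal O.toValuationSubring) :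
    x ∈ IsLocalRing.maximalIdeal O.toValuationSubring := by
  rcases eq_or_lt_of_le hx with rfl | hx0
  · exact Ideal.zero_mem _
  have hx0' : (0 : K) < x := hx0
  have hxy' : (x : K) ≤ y := hxy
  have hy0' : (0 : K) < y := hx0'.trans_le hxy'
  have hmem : (x / y : K) ∈ O.carrier :=
    O.ordConnected'.out O.toSubring.zero_mem O.toSubring.one_mem
      ⟨(div_pos hx0' hy0').le, (div_le_one hy0').2 hxy'⟩
  have : x = (⟨(x / y : K), hmem⟩ : O.toValuationSubring) * y :=
    Subtype.ext (div_mul_cancel₀ (x : K) hy0'.ne').symm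
  rw [this]
  exact Ideal.mul_mem_left _ _ hy

instance ordConnected_fiber (O : ConvexSubring K) : ∀ a, Set.OrdConnected <| Quotient.mk
    (Submodule.quotientRel (IsLocalRing.maximalIdeal O.toValuationSubring)) ⁻¹' {a} := by
  refine fun a => ⟨?_⟩
  rintro x rfl y hy z ⟨hxz, hzy⟩
  rw [Set.mem_preimage, Set.mem_singleton_iff, Quotient.eq, Submodule.quotientRel_def] at hy ⊢
  exact O.mem_maximalIdeal_of_le (sub_nonneg.2 hxz) (sub_le_sub_right hzy x) hy

/-- The order that the residue field `k_O` inherits from `K`; see `residue_lt_residue`. -/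
noncomputable instance (O : ConvexSubring K) : LinearOrder O.ResidueField :=
  letI := Submodule.quotientRel (IsLocalRing.maximalIdeal O.toValuationSubring)
  haveI := Classical.decRel fun x y : O.toValuationSubring => x ≈ y
  inferInstanceAs (LinearOrder (Quotient _))

theorem residue_lt_residue (O : ConvexSubring K) {x y : O.toValuationSubring} :
    O.residue x < O.residue y ↔ (x : K) < y ∧ O.residue x ≠ O.residue y := by
  refine (Quotient.mk_lt_mk (H := ordConnected_fiber O)).trans ?_
  rw [← Quotient.eq_iff_equiv]
  rfl

/-- The value group `Γ_O = Kˣ / Oˣ`, written additively. Mathlib's `ValueGroup` is written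
multiplicatively, has an extra zero, and has the reverse order; see `val_le_val`. -/
abbrev ValueGroup (O : ConvexSubring K) : Type u :=
  (Additive (O.toValuationSubring.ValueGroup)ˣ)ᵒᵈ

/-- The valuation `v_O : Kˣ → Γ_O`. -/
noncomputable def val (O : ConvexSubring K) (x : Kˣ) : O.ValueGroup :=
  OrderDual.toDual (Additive.ofMul (Units.map O.toValuationSubring.valuation.toMonoidHom x))

theorem val_le_val (O : ConvexSubring K) (x y : Kˣ) :
    O.val x ≤ O.val y ↔ (y / x : K) ∈ O.toSubring := by
  change O.toValuationSubring.valuation (y : K) ≤ O.toValuationSubring.valuation (x : K) ↔ _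
  have hx : 0 < O.toValuationSubring.valuation (x : K) := by
    rw [zero_lt_iff, Valuation.ne_zero_iff]
    exact x.ne_zero
  rw [← div_le_one₀ hx, ← map_div₀]
  exact O.toValuationSubring.valuation_le_one_iff _

variable (K) in
/-- The convex subring of finite elements of `K`. -/
def finite : ConvexSubring K where
  carrier := {x | ∃ n : ℕ, |x| ≤ n}
  zero_mem' := ⟨0, by simp⟩
  one_mem' := ⟨1, by simp⟩
  add_mem' := by
    rintro x y ⟨m, hm⟩ ⟨n, hn⟩
    exact ⟨m + n, (abs_add_le x y).trans (by push_cast; exact add_le_add hm hn)⟩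
  mul_mem' := by
    rintro x y ⟨m, hm⟩ ⟨n, hn⟩
    refine ⟨m * n, ?_⟩
    rw [abs_mul, Nat.cast_mul]
    exact mul_le_mul hm hn (abs_nonneg y) m.cast_nonneg
  neg_mem' := by
    rintro x ⟨n, hn⟩
    exact ⟨n, by rwa [abs_neg]⟩
  ordConnected' := by
    refine ⟨?_⟩
    rintro x ⟨m, hm⟩ y ⟨n, hn⟩ z ⟨hxz, hzy⟩
    refine ⟨m + n, ?_⟩
    rw [abs_le] at hm hn ⊢
    have hm0 : (0 : K) ≤ m := m.cast_nonneg
    have hn0 : (0 : K) ≤ n := n.cast_nonneg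
    push_cast
    constructor <;> linarith

end ConvexSubring

/-- The value group `Γ` of `K` under the standard valuation, whose valuation ring consists of the
finite elements of `K`. -/
abbrev StandardValueGroup (K : Type u) [Field K] [LinearOrder K] [IsStrictOrderedRing K] :
    Type u :=
  (ConvexSubring.finite K).ValueGroup

/-! ### Back and forth between ordered abelian groups -/

/-! Resplendence reduces the claim to a consistency problem. A convex subring $O$, a map inducing
$k_O\cong\Gamma_O$ and a map inducing an injection $K\to k_O$ are described by finitely many
first-order axioms (`IsResidueValueData`), so it suffices to find one ordered field elementarily
equivalent to $K$ that carries such data.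

In an ultrapower $K_1$ of $K$ the finite elements form a proper convex subring $O_1$. Let $M$ be an
ultrapower of $K_1$. The corresponding ultrapower of $O_1$ is internal in $M$, so countable
saturation makes its residue field and value group $\eta_1$; both are divisible, the latter because
roots exist. Between two divisible $\eta_1$ groups, isomorphisms of countable subgroups can always
be extended (`IsOrderGraph.exists_extend_both`). No isomorphism of the whole groups is needed:
interleaving the back-and-forth with a Löwenheim–Skolem construction
(`ConvexSubring.exists_countable_subfield`) gives a countable elementary subfield of $M$ whose
residue classes and values are matched completely. Being countable, it injects into $\mathbb N$,
which embeds in the residue field.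

For the last claim, $\mathrm{Fin}\subseteq O$, so lifting values from $\Gamma_O$ to $\Gamma$ embeds
the ordered set $\Gamma_O\cong k_O$ in $\Gamma$. An ordered field is order isomorphic to its
interval $(-1,1)$, so a full-sized copy of $k_O$ lies in a bounded interval of $\Gamma$. -/

/-- Every cut of a linear order with countable sides is filled (Hausdorff's `η₁` property). -/
def IsEtaOne (Q : Type*) [Preorder Q] : Prop :=
  ∀ X Y : Set Q, X.Countable → Y.Countable → (∀ x ∈ X, ∀ y ∈ Y, x < y) →
    ∃ z, (∀ x ∈ X, x < z) ∧ ∀ y ∈ Y, z < y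

/-- Divisibility of an abelian group. -/
def IsDivisible (G : Type*) [AddCommGroup G] : Prop :=
  ∀ n : ℕ, n ≠ 0 → ∀ g : G, ∃ h, n • h = g

section OrderGraph

variable {G H : Type*} [AddCommGroup G] [LinearOrder G] [IsOrderedAddMonoid G]
  [AddCommGroup H] [LinearOrder H] [IsOrderedAddMonoid H]

/-- A subgroup of `G × H` is an order graph if it is the graph of an isomorphism of ordered groups
between its two projections. -/
def IsOrderGraph (R : AddSubgroup (G × H)) : Prop :=
  ∀ p ∈ R, (0 < p.1 ↔ 0 < p.2)

namespace IsOrderGraph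

omit [IsOrderedAddMonoid G] [IsOrderedAddMonoid H]

theorem bot : IsOrderGraph (⊥ : AddSubgroup (G × H)) := by
  rintro p hp
  rw [AddSubgroup.mem_bot] at hp
  simp [hp]

theorem iSup {R : ℕ → AddSubgroup (G × H)} (hR : Monotone R) (h : ∀ n, IsOrderGraph (R n)) :
    IsOrderGraph (⨆ n, R n) := by
  intro p hp
  obtain ⟨n, hn⟩ := (AddSubgroup.mem_iSup_of_directed hR.directed_le).1 hp
  exact h n p hn

end IsOrderGraph

/-- Membership in the subgroup generated by an order graph and a further pair. -/
theorem mem_sup_zmultiples {A : Type*} [AddCommGroup A] {R : AddSubgroup A} {q p : A} :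
    p ∈ R ⊔ AddSubgroup.zmultiples q ↔ ∃ r ∈ R, ∃ z : ℤ, r + z • q = p := by
  simp [AddSubgroup.mem_sup, AddSubgroup.mem_zmultiples_iff]

namespace IsOrderGraph

theorem countable_sup {A : Type*} [AddCommGroup A] {R : AddSubgroup A}
    (hR : (R : Set A).Countable) (q : A) :
    ((R ⊔ AddSubgroup.zmultiples q : AddSubgroup A) : Set A).Countable := by
  have : ((R ⊔ AddSubgroup.zmultiples q : AddSubgroup A) : Set A)
      = ⋃ z : ℤ, (fun r => r + z • q) '' R := by
    ext p
    simp only [SetLike.mem_coe, mem_sup_zmultiples, Set.mem_iUnion, Set.mem_image]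
    constructor
    · rintro ⟨r, hr, z, h⟩
      exact ⟨z, r, hr, h⟩
    · rintro ⟨z, r, hr, h⟩
      exact ⟨r, hr, z, h⟩
  rw [this]
  exact Set.countable_iUnion fun z => hR.image _

/-- Since `R` is a subgroup, comparison with zero, applied to differences, controls all comparisons.
-/
theorem fst_le_iff {R : AddSubgroup (G × H)} (h : IsOrderGraph R) {p q : G × H} (hp : p ∈ R)
    (hq : q ∈ R) : p.1 ≤ q.1 ↔ p.2 ≤ q.2 := by
  simpa using not_congr (h (p - q) (R.sub_mem hp hq))

theorem fst_eq_iff {R : AddSubgroup (G × H)} (h : IsOrderGraph R) {p q : G × H} (hp : p ∈ R)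
    (hq : q ∈ R) : p.1 = q.1 ↔ p.2 = q.2 := by
  rw [le_antisymm_iff, le_antisymm_iff, h.fst_le_iff hp hq, h.fst_le_iff hq hp]

/-- Multiplying a new element by `n` moves it into `R` without changing the signs of its
coordinates. -/
theorem sup_of_smul_mem {R : AddSubgroup (G × H)} (h : IsOrderGraph R) {n : ℕ} (hn : n ≠ 0)
    {g : G} {x : H} (hx : (n • g, n • x) ∈ R) :
    IsOrderGraph (R ⊔ AddSubgroup.zmultiples (g, x)) := by
  intro p hp
  obtain ⟨r, hr, z, rfl⟩ := mem_sup_zmultiples.1 hp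
  have key := h (n • r + z • (n • g, n • x)) (R.add_mem (R.nsmul_mem hr n) (R.zsmul_mem hx z))
  have e : n • r + z • (n • g, n • x) = n • (r + z • (g, x)) := by
    rw [smul_add, ← Prod.smul_mk, smul_comm z n]
  rw [e, Prod.smul_fst, Prod.smul_snd] at key
  simpa only [smul_pos_iff_of_pos_left (Nat.pos_of_ne_zero hn)] using key

/-- The sign of a new element `r ± n • (g, x)` is a comparison of an element of `R` with `n • (g,
x)`. No equality occurs in the first coordinate, so the two one-way implications become
equivalences. -/
theorem sup_of_cut {R : AddSubgroup (G × H)} (h : IsOrderGraph R) {g : G} {x : H}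
    (hg : ∀ n : ℕ, n ≠ 0 → ∀ p ∈ R, p.1 ≠ n • g)
    (hlt : ∀ n : ℕ, n ≠ 0 → ∀ p ∈ R, p.1 < n • g → p.2 < n • x)
    (hgt : ∀ n : ℕ, n ≠ 0 → ∀ p ∈ R, n • g < p.1 → n • x < p.2) :
    IsOrderGraph (R ⊔ AddSubgroup.zmultiples (g, x)) := by
  have iff₁ : ∀ n : ℕ, n ≠ 0 → ∀ p ∈ R, (p.1 < n • g ↔ p.2 < n • x) := fun n hn p hp =>
    ⟨hlt n hn p hp, fun h' => ((hg n hn p hp).lt_or_gt).resolve_right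
      fun h'' => lt_asymm h' (hgt n hn p hp h'')⟩
  have iff₂ : ∀ n : ℕ, n ≠ 0 → ∀ p ∈ R, (n • g < p.1 ↔ n • x < p.2) := fun n hn p hp =>
    ⟨hgt n hn p hp, fun h' => ((hg n hn p hp).lt_or_gt).resolve_left
      fun h'' => lt_asymm h' (hlt n hn p hp h'')⟩
  intro p hp
  obtain ⟨r, hr, z, rfl⟩ := mem_sup_zmultiples.1 hp
  obtain ⟨n, rfl | rfl⟩ := z.eq_nat_or_neg
  · rcases eq_or_ne n 0 with rfl | hn
    · simpa using h r hr
    · have := iff₁ n hn (-r) (R.neg_mem hr)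
      simpa [neg_lt_iff_pos_add'] using this
  · rcases eq_or_ne n 0 with rfl | hn
    · simpa using h r hr
    · have := iff₂ n hn r hr
      simpa [← sub_eq_add_neg] using this

/-- Either some positive multiple of `g` is already matched and divisibility determines `x`, or `g`
makes a cut in the divisible hull of the first projection, and `x` is taken from the corresponding
countable cut in `H`. -/
theorem exists_extend (hH : IsDivisible H) (eH : IsEtaOne H) {R : AddSubgroup (G × H)}
    (h : IsOrderGraph R) (hc : (R : Set (G × H)).Countable) (g : G) :
    ∃ R' : AddSubgroup (G × H), R ≤ R' ∧ IsOrderGraph R' ∧ (R' : Set (G × H)).Countable ∧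
      ∃ x, (g, x) ∈ R' := by
  suffices ∃ x, IsOrderGraph (R ⊔ AddSubgroup.zmultiples (g, x)) by
    obtain ⟨x, hx⟩ := this
    exact ⟨_, le_sup_left, hx, countable_sup hc _, x,
      (le_sup_right : _ ≤ R ⊔ AddSubgroup.zmultiples (g, x)) (AddSubgroup.mem_zmultiples _)⟩
  by_cases hg : ∃ n : ℕ, n ≠ 0 ∧ ∃ p ∈ R, p.1 = n • g
  · obtain ⟨n, hn, p, hp, hpg⟩ := hg
    obtain ⟨x, hx⟩ := hH n hn p.2
    exact ⟨x, h.sup_of_smul_mem hn (by rwa [hx, ← hpg])⟩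
  · push Not at hg
    choose! d hd using hH
    -- With `d n h` playing the role of $h/n$, the pairs `(p, n)` in `A` and `B` represent the
    -- fractions `p.1 / n` below and above `g`.
    let A : Set ((G × H) × ℕ) := {q | q.1 ∈ R ∧ q.2 ≠ 0 ∧ q.1.1 < q.2 • g}
    let B : Set ((G × H) × ℕ) := {q | q.1 ∈ R ∧ q.2 ≠ 0 ∧ q.2 • g < q.1.1}
    have hcp : ((R : Set (G × H)) ×ˢ (Set.univ : Set ℕ)).Countable := hc.prod Set.countable_univ
    have hA : A.Countable := Set.Countable.mono (fun q hq => Set.mk_mem_prod hq.1 (Set.mem_univ _)) hcp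
    have hB : B.Countable := Set.Countable.mono (fun q hq => Set.mk_mem_prod hq.1 (Set.mem_univ _)) hcp
    obtain ⟨x, hx₁, hx₂⟩ := eH ((fun q => d q.2 q.1.2) '' A) ((fun q => d q.2 q.1.2) '' B)
      (hA.image _) (hB.image _) (by
        rintro _ ⟨⟨p, n⟩, ⟨hp, hn, hlt⟩, rfl⟩ _ ⟨⟨p', m⟩, ⟨hp', hm, hlt'⟩, rfl⟩
        dsimp only at *
        -- Clearing denominators leaves a comparison inside `R`, which passes to the second
        -- coordinates.
        have h₁ : m • p.1 < n • p'.1 := by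
          calc m • p.1 < m • n • g := (smul_lt_smul_iff_of_pos_left (Nat.pos_of_ne_zero hm)).2 hlt
            _ = n • m • g := smul_comm _ _ _
            _ < n • p'.1 := (smul_lt_smul_iff_of_pos_left (Nat.pos_of_ne_zero hn)).2 hlt'
        have h₂ : m • p.2 < n • p'.2 := by
          have := (h (n • p' - m • p) (R.sub_mem (R.nsmul_mem hp' n) (R.nsmul_mem hp m))).1
            (by simpa using h₁)
          simpa using this
        have h₃ : (m * n) • d n p.2 < (m * n) • d m p'.2 := by
          rwa [mul_smul, hd n hn, mul_comm, mul_smul, hd m hm]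
        exact lt_of_smul_lt_smul_left h₃ (Nat.zero_le _))
    refine ⟨x, h.sup_of_cut (fun n hn p hp => hg n hn p hp) (fun n hn p hp hlt => ?_)
      (fun n hn p hp hlt => ?_)⟩
    · have := hx₁ _ ⟨(p, n), ⟨hp, hn, hlt⟩, rfl⟩
      rw [← hd n hn p.2]
      exact (smul_lt_smul_iff_of_pos_left (Nat.pos_of_ne_zero hn)).2 this
    · have := hx₂ _ ⟨(p, n), ⟨hp, hn, hlt⟩, rfl⟩
      rw [← hd n hn p.2]
      exact (smul_lt_smul_iff_of_pos_left (Nat.pos_of_ne_zero hn)).2 this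

theorem exists_extend_countable (hH : IsDivisible H) (eH : IsEtaOne H) {R : AddSubgroup (G × H)}
    (h : IsOrderGraph R) (hc : (R : Set (G × H)).Countable) {X : Set G} (hX : X.Countable) :
    ∃ R' : AddSubgroup (G × H), R ≤ R' ∧ IsOrderGraph R' ∧ (R' : Set (G × H)).Countable ∧
      ∀ g ∈ X, ∃ x, (g, x) ∈ R' := by
  rcases X.eq_empty_or_nonempty with rfl | hne
  · exact ⟨R, le_rfl, h, hc, by simp⟩
  obtain ⟨e, rfl⟩ := hX.exists_eq_range hne
  let P := {R : AddSubgroup (G × H) // IsOrderGraph R ∧ (R : Set (G × H)).Countable}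
  have step : ∀ (S : P) (g : G), ∃ S' : P, S.1 ≤ S'.1 ∧ ∃ x, (g, x) ∈ S'.1 := fun S g =>
    let ⟨S', h₁, h₂, h₃, h₄⟩ := S.2.1.exists_extend hH eH S.2.2 g
    ⟨⟨S', h₂, h₃⟩, h₁, h₄⟩
  choose next hle hmem using step
  let s : ℕ → P := fun n => Nat.rec ⟨R, h, hc⟩ (fun n S => next S (e n)) n
  have hmono : Monotone fun n => (s n).1 := monotone_nat_of_le_succ fun n => hle (s n) (e n)
  refine ⟨⨆ n, (s n).1, le_iSup (fun n => (s n).1) 0, IsOrderGraph.iSup hmono fun n => (s n).2.1,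
    ?_, ?_⟩
  · rw [AddSubgroup.coe_iSup_of_directed hmono.directed_le]
    exact Set.countable_iUnion fun n => (s n).2.2
  · rintro _ ⟨n, rfl⟩
    obtain ⟨x, hx⟩ := hmem (s n) (e n)
    exact ⟨x, le_iSup (fun n => (s n).1) (n + 1) hx⟩

omit [IsOrderedAddMonoid G] [IsOrderedAddMonoid H] in
theorem swap {R : AddSubgroup (G × H)} (h : IsOrderGraph R) :
    IsOrderGraph (R.comap (AddEquiv.prodComm : H × G ≃+ G × H).toAddMonoidHom) :=
  fun p hp => (h p.swap hp).symm

/-- A countable order graph can be extended to one whose projections contain given countable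
sets. -/
theorem exists_extend_both (hG : IsDivisible G) (eG : IsEtaOne G) (hH : IsDivisible H)
    (eH : IsEtaOne H) {R : AddSubgroup (G × H)}
    (h : IsOrderGraph R) (hc : (R : Set (G × H)).Countable) {X : Set G} (hX : X.Countable)
    {Y : Set H} (hY : Y.Countable) :
    ∃ R' : AddSubgroup (G × H), R ≤ R' ∧ IsOrderGraph R' ∧ (R' : Set (G × H)).Countable ∧
      (∀ g ∈ X, ∃ x, (g, x) ∈ R') ∧ ∀ x ∈ Y, ∃ g, (g, x) ∈ R' := by
  obtain ⟨R₁, hle₁, h₁, hc₁, hX₁⟩ := h.exists_extend_countable hH eH hc hX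
  obtain ⟨R₂, hle₂, h₂, hc₂, hY₂⟩ := h₁.swap.exists_extend_countable hG eG
    (hc₁.preimage (Equiv.prodComm H G).injective) hY
  have hle : R₁ ≤ R₂.comap (AddEquiv.prodComm : G × H ≃+ H × G).toAddMonoidHom :=
    fun p hp => hle₂ (show p.swap.swap ∈ R₁ from hp)
  refine ⟨R₂.comap (AddEquiv.prodComm : G × H ≃+ H × G).toAddMonoidHom, hle₁.trans hle, h₂.swap,
    hc₂.preimage (Equiv.prodComm G H).injective, fun g hg => ?_, fun x hx => hY₂ x hx⟩
  obtain ⟨x, hx⟩ := hX₁ g hg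
  exact ⟨x, hle hx⟩

end IsOrderGraph
end OrderGraph

/-- A divisible ordered abelian group is densely ordered. -/
theorem IsDivisible.denselyOrdered {G : Type*} [AddCommGroup G] [LinearOrder G]
    [IsOrderedAddMonoid G] (h : IsDivisible G) : DenselyOrdered G := by
  refine ⟨fun a b hab => ?_⟩
  obtain ⟨c, hc⟩ := h 2 two_ne_zero (a + b)
  rw [two_nsmul] at hc
  refine ⟨c, ?_, ?_⟩
  · by_contra! hca
    exact (add_le_add hca hca).not_gt (hc ▸ add_lt_add_right hab a)
  · by_contra! hca
    exact (add_le_add hca hca).not_gt (hc ▸ add_lt_add_left hab b)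

/-! ### Ultrapowers and their countable saturation -/

open Filter in
/-- The ultrapower of `K` with respect to a nonprincipal ultrafilter on `ℕ`. -/
abbrev Ultrapower (K : Type*) := Germ (hyperfilter ℕ : Filter ℕ) K

namespace Ultrapower

open Filter

/-- Internal subsets of an ultrapower. -/
def IsInternal {K : Type*} (A : Set (Ultrapower K)) : Prop :=
  ∃ B : ℕ → Set K, ∀ z : ℕ → K, (z : Ultrapower K) ∈ A ↔ ∀ᶠ i in hyperfilter ℕ, z i ∈ B i

/-- Ultrapowers are countably saturated. -/
theorem nonempty_iInter {K : Type*} {A : ℕ → Set (Ultrapower K)} (hA : ∀ n, IsInternal (A n))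
    (h : ∀ n, ∃ z, ∀ j ≤ n, z ∈ A j) : ∃ z, ∀ j, z ∈ A j := by
  choose B hB using hA
  have h' : ∀ n, ∃ w : ℕ → K, ∀ j ≤ n, (w : Ultrapower K) ∈ A j := fun n => by
    obtain ⟨z, hz⟩ := h n
    induction z using Germ.inductionOn with
    | _ w => exact ⟨w, hz⟩
  choose w hw using h'
  classical
  let P : ℕ → ℕ → Prop := fun i n => ∀ j ≤ n, w n i ∈ B j i
  -- Diagonal choice: coordinate `i` uses the last partial solution with index at most `i` that
  -- meets all its conditions there. The default value `0` of the search is harmless, since `P i j`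
  -- and `j ≤ i` hold for almost all `i`.
  refine ⟨(fun i => w (Nat.findGreatest (P i) i) i : ℕ → K), fun j => (hB j _).2 ?_⟩
  have h₁ : ∀ᶠ i in hyperfilter ℕ, P i j := by
    have : ∀ᶠ i in hyperfilter ℕ, ∀ l ∈ Set.Iic j, w j i ∈ B l i :=
      (eventually_all_finite (Set.finite_Iic j)).2 fun l hl => (hB l _).1 (hw j l hl)
    exact this
  have h₂ : ∀ᶠ i in hyperfilter ℕ, j ≤ i := Nat.hyperfilter_le_atTop (eventually_ge_atTop j)
  filter_upwards [h₁, h₂] with i hi hji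
  exact Nat.findGreatest_spec (P := P i) hji hi j (Nat.le_findGreatest hji hi)

theorem nonempty_iInter_of_countable {K ι : Type*} [Countable ι] [Nonempty ι]
    {A : ι → Set (Ultrapower K)} (hA : ∀ i, IsInternal (A i))
    (h : ∀ s : Finset ι, ∃ z, ∀ i ∈ s, z ∈ A i) : ∃ z, ∀ i, z ∈ A i := by
  classical
  obtain ⟨e, he⟩ := exists_surjective_nat ι
  obtain ⟨z, hz⟩ := nonempty_iInter (A := A ∘ e) (fun n => hA _) fun n => by
    obtain ⟨z, hz⟩ := h ((Finset.range (n + 1)).image e)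
    exact ⟨z, fun j hj => hz _ (Finset.mem_image_of_mem _ (by simp; omega))⟩
  exact ⟨z, fun i => by obtain ⟨n, rfl⟩ := he i; exact hz n⟩

/-- A dense order without endpoints that is parametrized by an internal set, in such a way that
open rays are internal, is an `η₁` order. -/
theorem isEtaOne {K Q : Type*} [LinearOrder Q] [DenselyOrdered Q] [NoMinOrder Q] [NoMaxOrder Q]
    [Nonempty Q] {D : Set (Ultrapower K)} (hD : IsInternal D) {π : D → Q}
    (hπ : Function.Surjective π) (hgt : ∀ d, IsInternal {z | ∃ h : z ∈ D, π d < π ⟨z, h⟩})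
    (hlt : ∀ d, IsInternal {z | ∃ h : z ∈ D, π ⟨z, h⟩ < π d}) : IsEtaOne Q := by
  intro X Y hX hY hXY
  have := hX.to_subtype
  have := hY.to_subtype
  choose s hs using hπ
  -- The index `none` forces the solution into `D` and keeps the index type nonempty even if `X` and
  -- `Y` are empty.
  let A : Option (X ⊕ Y) → Set (Ultrapower K)
    | none => D
    | some (.inl x) => {z | ∃ h : z ∈ D, π (s x) < π ⟨z, h⟩}
    | some (.inr y) => {z | ∃ h : z ∈ D, π ⟨z, h⟩ < π (s y)}
  have hA : ∀ i, IsInternal (A i)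
    | none => hD
    | some (.inl x) => hgt _
    | some (.inr y) => hlt _
  obtain ⟨z, hz⟩ := nonempty_iInter_of_countable hA fun t => by
    classical
    obtain ⟨q, hq₁, hq₂⟩ := Order.exists_between_finsets
      ((t.preimage (fun x => some (.inl x)) (by intro; simp)).image (Subtype.val : X → Q))
      ((t.preimage (fun x => some (.inr x)) (by intro; simp)).image (Subtype.val : Y → Q)) (by
        intro x hx y hy
        obtain ⟨x, -, rfl⟩ := Finset.mem_image.1 hx
        obtain ⟨y, -, rfl⟩ := Finset.mem_image.1 hy
        exact hXY _ x.2 _ y.2)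
    refine ⟨s q, ?_⟩
    rintro (_ | x | y) hi
    · exact (s q).2
    · exact ⟨(s q).2, by
        rw [hs, hs]; exact hq₁ x (Finset.mem_image_of_mem _ (Finset.mem_preimage.2 hi))⟩
    · exact ⟨(s q).2, by
        rw [hs, hs]; exact hq₂ y (Finset.mem_image_of_mem _ (Finset.mem_preimage.2 hi))⟩
  refine ⟨π ⟨z, hz none⟩, fun x hx => ?_, fun y hy => ?_⟩
  · obtain ⟨h, h'⟩ := hz (some (.inl ⟨x, hx⟩))
    rwa [hs] at h'
  · obtain ⟨h, h'⟩ := hz (some (.inr ⟨y, hy⟩))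
    rwa [hs] at h'

end Ultrapower

/-! ### Residue fields and value groups of convex subrings -/

namespace ConvexSubring

variable {K : Type u} [Field K] [LinearOrder K] [IsStrictOrderedRing K] (O : ConvexSubring K)

/-- Stated with a quantifier over `O` rather than with ideals or inverses, to match the first-order
axioms used later. -/
theorem residue_eq_zero_iff {x : O.toValuationSubring} :
    O.residue x = 0 ↔ ∀ w ∈ O.toSubring, w * (x : K) ≠ 1 := by
  refine (IsLocalRing.residue_eq_zero_iff x).trans ?_
  rw [IsLocalRing.mem_maximalIdeal, mem_nonunits_iff, isUnit_iff_exists_inv']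
  constructor
  · intro h w hw hwx
    exact h ⟨⟨w, hw⟩, Subtype.ext hwx⟩
  · rintro h ⟨w, hw⟩
    exact h w w.2 (congrArg Subtype.val hw)

theorem residue_eq_iff {x y : O.toValuationSubring} :
    O.residue x = O.residue y ↔ ∀ w ∈ O.toSubring, w * (x - y : K) ≠ 1 := by
  rw [← sub_eq_zero, ← map_sub, residue_eq_zero_iff]
  rfl

/-- The difference is a positive unit of `O`. This form can be checked coordinatewise, which makes
open rays internal in an ultrapower. -/
theorem residue_lt_residue_iff_inv_mem {x y : O.toValuationSubring} :
    O.residue x < O.residue y ↔ (x : K) < y ∧ (y - x : K)⁻¹ ∈ O.toSubring := by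
  rw [O.residue_lt_residue]
  refine and_congr_right fun h => ?_
  have h' : (y - x : K) ≠ 0 := (sub_pos.2 h).ne'
  rw [ne_comm, ne_eq, residue_eq_iff]
  push Not
  constructor
  · rintro ⟨w, hw, hwx⟩
    rwa [← eq_inv_of_mul_eq_one_left hwx]
  · exact fun h => ⟨_, h, inv_mul_cancel₀ h'⟩

theorem residue_le_residue_iff {x y : O.toValuationSubring} :
    O.residue x ≤ O.residue y ↔ (x : K) ≤ y ∨ ∀ w ∈ O.toSubring, w * (x - y : K) ≠ 1 := by
  rw [← not_lt, O.residue_lt_residue, not_and_or, not_lt, not_ne_iff, eq_comm, residue_eq_iff]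

instance : IsStrictOrderedRing O.ResidueField := by
  have hadd : ∀ a b : O.ResidueField, a < b → ∀ c, c + a < c + b := by
    intro a b hab c
    obtain ⟨x, rfl⟩ := O.residue_surjective a
    obtain ⟨y, rfl⟩ := O.residue_surjective b
    obtain ⟨z, rfl⟩ := O.residue_surjective c
    rw [residue_lt_residue_iff_inv_mem] at hab
    rw [← map_add, ← map_add, residue_lt_residue_iff_inv_mem]
    simpa using! hab
  have : IsOrderedAddMonoid O.ResidueField := 
    { add_le_add_left := fun a b hab c => by
        rcases hab.eq_or_lt with rfl | hab
        · exact le_rfl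
        · rw [add_comm a, add_comm b]
          exact (hadd a b hab c).le }
  have : ZeroLEOneClass O.ResidueField := ⟨by
    rw [← map_zero O.residue, ← map_one O.residue, residue_le_residue_iff]
    exact Or.inl zero_le_one⟩
  refine IsStrictOrderedRing.of_mul_pos fun a b ha hb => ?_
  obtain ⟨x, rfl⟩ := O.residue_surjective a
  obtain ⟨y, rfl⟩ := O.residue_surjective b
  rw [← map_zero O.residue, residue_lt_residue_iff_inv_mem] at ha hb
  rw [← map_mul, ← map_zero O.residue, residue_lt_residue_iff_inv_mem]
  refine ⟨mul_pos ha.1 hb.1, ?_⟩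
  have := O.toSubring.mul_mem ha.2 hb.2
  simpa [mul_inv, mul_comm] using! this

theorem val_surjective : Function.Surjective O.val := by
  intro g
  obtain ⟨x, hx⟩ := O.toValuationSubring.valuation_surjective (g.ofDual.toMul : _)
  have hx0 : x ≠ 0 := by
    rintro rfl
    exact g.ofDual.toMul.ne_zero (hx.symm.trans (map_zero _))
  exact ⟨Units.mk0 x hx0, congrArg (OrderDual.toDual ∘ Additive.ofMul) (Units.ext hx)⟩

theorem val_mul (x y : Kˣ) : O.val (x * y) = O.val x + O.val y := by
  simp only [val, map_mul]
  rfl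

theorem val_neg (x : Kˣ) : O.val (-x) = O.val x := by
  apply le_antisymm <;> rw [val_le_val] <;> simp [O.toSubring.neg_mem, O.toSubring.one_mem]

/-- The valuation as a homomorphism of groups. -/
noncomputable def valHom : Additive Kˣ →+ O.ValueGroup :=
  AddMonoidHom.mk' (fun x => O.val x.toMul) fun x y => O.val_mul x.toMul y.toMul

theorem val_lt_val (x y : Kˣ) : O.val x < O.val y ↔ (x / y : K) ∉ O.toSubring := by
  rw [← not_le, val_le_val]

/-- An `n`-th root of a positive element has an `n`-th part of its value, and signs do not affect
values. -/
theorem isDivisible_valueGroup (h : ∀ n : ℕ, n ≠ 0 → ∀ x : K, 0 ≤ x → ∃ r, x = r ^ n) :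
    IsDivisible O.ValueGroup := by
  intro n hn g
  have key : ∀ x : Kˣ, 0 < (x : K) → ∃ h, n • h = O.val x := by
    intro x hx
    obtain ⟨r, hr⟩ := h n hn x hx.le
    have hr0 : r ≠ 0 := by
      rintro rfl
      rw [zero_pow hn] at hr
      exact hx.ne' hr
    refine ⟨O.val (Units.mk0 r hr0), ?_⟩
    have : x = (Units.mk0 r hr0) ^ n := Units.ext (by simpa using hr)
    rw [this]
    exact (map_nsmul O.valHom n (Additive.ofMul (Units.mk0 r hr0))).symm
  obtain ⟨x, rfl⟩ := O.val_surjective g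
  rcases lt_or_gt_of_ne x.ne_zero with hx | hx
  · obtain ⟨y, hy⟩ := key (-x) (by simpa using hx)
    exact ⟨y, by rw [hy, val_neg]⟩
  · exact key x hx

theorem isDivisible_residueField : IsDivisible O.ResidueField := by
  intro n hn g
  exact ⟨g / n, by rw [nsmul_eq_mul]; field_simp⟩

open Filter

/-- The ultrapower of a convex subring. -/
def ultrapower : ConvexSubring (Ultrapower K) where
  carrier := {z | Germ.LiftPred (· ∈ O.toSubring) z}
  zero_mem' := Germ.liftPred_coe.2 (.of_forall fun _ => O.toSubring.zero_mem)
  one_mem' := Germ.liftPred_coe.2 (.of_forall fun _ => O.toSubring.one_mem)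
  add_mem' {x y} := by
    induction x, y using Germ.inductionOn₂ with
    | _ x y => exact fun hx hy => hx.mp (hy.mono fun i h h' => O.toSubring.add_mem h' h)
  mul_mem' {x y} := by
    induction x, y using Germ.inductionOn₂ with
    | _ x y => exact fun hx hy => hx.mp (hy.mono fun i h h' => O.toSubring.mul_mem h' h)
  neg_mem' {x} := by
    induction x using Germ.inductionOn with
    | _ x => exact fun hx => hx.mono fun i h => O.toSubring.neg_mem h
  ordConnected' := ⟨by
    intro x hx y hy z hz
    induction x, y, z using Germ.inductionOn₃ with
    | _ x y z =>
      have h₁ : ∀ᶠ i in hyperfilter ℕ, x i ≤ z i := Germ.coe_le.1 hz.1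
      have h₂ : ∀ᶠ i in hyperfilter ℕ, z i ≤ y i := Germ.coe_le.1 hz.2
      have h₃ : ∀ᶠ i in hyperfilter ℕ, x i ∈ O.toSubring := hx
      have h₄ : ∀ᶠ i in hyperfilter ℕ, y i ∈ O.toSubring := hy
      change ∀ᶠ i in hyperfilter ℕ, z i ∈ O.toSubring
      filter_upwards [h₁, h₂, h₃, h₄] with i h₁ h₂ h₃ h₄
      exact O.ordConnected'.out h₃ h₄ ⟨h₁, h₂⟩⟩

omit [IsStrictOrderedRing K] in
theorem coe_mem_ultrapower {x : ℕ → K} :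
    (x : Ultrapower K) ∈ O.ultrapower.toSubring ↔ ∀ᶠ i in hyperfilter ℕ, x i ∈ O.toSubring :=
  Iff.rfl

theorem isEtaOne_residueField : IsEtaOne O.ultrapower.ResidueField := by
  refine Ultrapower.isEtaOne (D := {z | z ∈ O.ultrapower.toSubring})
    ⟨fun _ => {x | x ∈ O.toSubring}, fun z => Iff.rfl⟩
    (π := fun d => O.ultrapower.residue ⟨d, d.2⟩)
    (fun q => let ⟨x, hx⟩ := O.ultrapower.residue_surjective q; ⟨⟨x.1, x.2⟩, hx⟩) ?_ ?_
  · rintro ⟨d, hd⟩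
    induction d using Germ.inductionOn with
    | _ d =>
      refine ⟨fun i => {z | z ∈ O.toSubring ∧ d i < z ∧ (z - d i)⁻¹ ∈ O.toSubring}, fun z => ?_⟩
      simp only [residue_lt_residue_iff_inv_mem, Set.mem_ofPred_eq, exists_prop, eventually_and,
        Germ.coe_lt.symm]
      rfl
  · rintro ⟨d, hd⟩
    induction d using Germ.inductionOn with
    | _ d =>
      refine ⟨fun i => {z | z ∈ O.toSubring ∧ z < d i ∧ (d i - z)⁻¹ ∈ O.toSubring}, fun z => ?_⟩
      simp only [residue_lt_residue_iff_inv_mem, Set.mem_ofPred_eq, exists_prop, eventually_and,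
        Germ.coe_lt.symm]
      rfl

theorem nontrivial_valueGroup {x : K} (hx : x ∉ O.toSubring) : Nontrivial O.ValueGroup := by
  have hx0 : x ≠ 0 := fun h => hx (h ▸ O.toSubring.zero_mem)
  refine ⟨O.val (Units.mk0 x hx0), O.val 1, ne_of_lt ?_⟩
  rw [val_lt_val]
  simpa using hx

/-- Nontriviality excludes endpoints and divisibility gives density. Rays are described by
nonmembership in `O`, which is coordinatewise because an ultrafilter commutes with negation. -/
theorem isEtaOne_valueGroup [Nontrivial O.ultrapower.ValueGroup]
    (hdiv : IsDivisible O.ultrapower.ValueGroup) : IsEtaOne O.ultrapower.ValueGroup := by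
  have := hdiv.denselyOrdered
  have hcoe : ∀ z : ℕ → K, (z : Ultrapower K) ≠ 0 ↔ ∀ᶠ i in hyperfilter ℕ, z i ≠ 0 := fun z => by
    rw [← Germ.coe_zero, ne_eq, Germ.coe_eq, EventuallyEq, ← Ultrafilter.eventually_not]
    rfl
  refine Ultrapower.isEtaOne (D := {z | z ≠ 0}) ⟨fun _ => {x | x ≠ 0}, hcoe⟩
    (π := fun d => O.ultrapower.val (Units.mk0 d d.2))
    (fun q => let ⟨x, hx⟩ := O.ultrapower.val_surjective q
      ⟨⟨x.1, x.ne_zero⟩, by rw [← hx]; exact congrArg _ (Units.ext rfl)⟩) ?_ ?_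
  · rintro ⟨d, hd⟩
    induction d using Germ.inductionOn with
    | _ d =>
      refine ⟨fun i => {z | z ≠ 0 ∧ d i / z ∉ O.toSubring}, fun z => ?_⟩
      simp only [val_lt_val, Set.mem_ofPred_eq, Units.val_mk0, exists_prop, eventually_and, ← hcoe,
        Ultrafilter.eventually_not]
      rfl
  · rintro ⟨d, hd⟩
    induction d using Germ.inductionOn with
    | _ d =>
      refine ⟨fun i => {z | z ≠ 0 ∧ z / d i ∉ O.toSubring}, fun z => ?_⟩
      simp only [val_lt_val, Set.mem_ofPred_eq, Units.val_mk0, exists_prop, eventually_and, ← hcoe,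
        Ultrafilter.eventually_not]
      rfl

end ConvexSubring

/-! ### Ultrapowers of ordered fields: roots and infinite elements -/

namespace Ultrapower

open Filter

variable {K : Type u} [Field K] [LinearOrder K] [IsStrictOrderedRing K]

omit [IsStrictOrderedRing K] in
theorem exists_eq_pow (h : ∀ n : ℕ, n ≠ 0 → ∀ x : K, 0 ≤ x → ∃ r, x = r ^ n) (n : ℕ) (hn : n ≠ 0)
    (x : Ultrapower K) (hx : 0 ≤ x) : ∃ r, x = r ^ n := by
  induction x using Germ.inductionOn with
  | _ x =>
    have hx' : ∀ᶠ i in hyperfilter ℕ, 0 ≤ x i := Germ.coe_le.1 hx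
    choose! r hr using h n hn
    exact ⟨(fun i => r (x i) : ℕ → K), Germ.coe_eq.2 (hx'.mono fun i hi => hr _ hi)⟩

/-- An ultrapower of an ordered field is not archimedean. -/
theorem exists_not_mem_finite : ∃ x : Ultrapower K, x ∉ (ConvexSubring.finite _).toSubring := by
  refine ⟨(fun i : ℕ => (i : K) : ℕ → K), ?_⟩
  rintro ⟨n, hn⟩
  have h₁ : ((fun i : ℕ => (i : K) : ℕ → K) : Ultrapower K) ≤ ((fun _ => (n : K) : ℕ → K)) :=
    (le_abs_self _).trans hn
  have h₂ : ∀ᶠ i : ℕ in hyperfilter ℕ, (i : K) ≤ n := Germ.coe_le.1 h₁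
  have h₃ : ∀ᶠ i in hyperfilter ℕ, n + 1 ≤ i :=
    Nat.hyperfilter_le_atTop (eventually_ge_atTop (n + 1))
  obtain ⟨i, hi₁, hi₂⟩ := (h₂.and h₃).exists
  have := Nat.cast_le.1 hi₁
  omega

omit [IsStrictOrderedRing K] in
theorem const_not_mem_ultrapower {O : ConvexSubring K} {x : K} (hx : x ∉ O.toSubring) :
    ((fun _ => x : ℕ → K) : Ultrapower K) ∉ O.ultrapower.toSubring := by
  rw [O.coe_mem_ultrapower]
  simpa using hx

end Ultrapower

/-! ### Elementary equivalence -/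

namespace FirstOrder.Language

/-- A countable chain of countable elementary substructures, built in step with a chain of data of
another kind: a step extends the data according to the set of elements present so far, after which
elements that are called for by the new data are adjoined. -/
theorem exists_elementarySubstructure_of_step (L : Language.{0, 0}) [Countable L.Symbols]
    {M : Type u} [L.Structure M] [Nonempty M] {P : Type*} (step : P → Set M → P)
    (gen : P → Set M → Set M) (hgen : ∀ p s, s.Countable → (gen p s).Countable) (p₀ : P) :
    ∃ (S : L.ElementarySubstructure M) (p : ℕ → P) (s : ℕ → Set M), Monotone s ∧
      (∀ n, (s n).Countable) ∧ (S : Set M) = ⋃ n, s n ∧ p 0 = p₀ ∧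
      (∀ n, p (n + 1) = step (p n) (s n)) ∧ ∀ n, gen (p (n + 1)) (s n) ⊆ s (n + 1) := by
  -- Substructures closed under Skolem functions are elementary, unions of chains of them are again
  -- closed, and closures of countable sets stay countable.
  let L' := L.sum L.skolem₁
  have : Countable (Σ l, L'.Functions l) := by
    rw [← Cardinal.mk_le_aleph0_iff]
    refine card_functions_sum_skolem₁_le.trans (max_le le_rfl ?_)
    exact Cardinal.mk_le_aleph0_iff.2 inferInstance
  let T : Type _ := P × {s : L'.Substructure M // (s : Set M).Countable}
  let nextP : T → P := fun t => step t.1 t.2.1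
  let nextS : T → L'.Substructure M :=
    fun t => Substructure.closure L' ((t.2.1 : Set M) ∪ gen (nextP t) t.2.1)
  have hnext : ∀ t, (nextS t : Set M).Countable := fun t =>
    Set.countable_coe_iff.1
      (Set.Countable.substructure_closure L' (t.2.2.union (hgen _ _ t.2.2)))
  let t : ℕ → T := fun n => Nat.rec
    ⟨p₀, Substructure.closure L' ∅,
      Set.countable_coe_iff.1 (Set.Countable.substructure_closure L' Set.countable_empty)⟩
    (fun _ t => ⟨nextP t, nextS t, hnext t⟩) n
  have hmono : Monotone fun n => (t n).2.1 := monotone_nat_of_le_succ fun n =>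
    (Set.subset_union_left.trans (Substructure.subset_closure (L := L')) :
      ((t n).2.1 : Set M) ⊆ nextS (t n))
  refine ⟨(⨆ n, (t n).2.1 : L'.Substructure M).elementarySkolem₁Reduct, fun n => (t n).1,
    fun n => (t n).2.1, hmono, fun n => (t n).2.2, ?_, rfl, fun n => rfl, fun n => ?_⟩
  · ext x
    exact (Substructure.mem_iSup_of_directed hmono.directed_le).trans (by simp)
  · exact Set.subset_union_right.trans (Substructure.subset_closure (L := L'))

end FirstOrder.Language

open FirstOrder Language

/-- `K` and `F` satisfy the same sentences in the language of ordered rings. -/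
def OrderedFieldEquiv (K F : Type*) [Field K] [LinearOrder K] [Field F] [LinearOrder F] : Prop :=
  letI := Language.orderedRingStructure K
  letI := Language.orderedRingStructure F
  ∀ (φ : Language.orderedRing.Formula (Fin 0)) (a : Fin 0 → K) (b : Fin 0 → F),
    φ.Realize a ↔ φ.Realize b

theorem OrderedFieldEquiv.trans {K F E : Type*} [Field K] [LinearOrder K] [Field F] [LinearOrder F]
    [Field E] [LinearOrder E] (h : OrderedFieldEquiv K F) (h' : OrderedFieldEquiv F E) :
    OrderedFieldEquiv K E :=
  fun φ a b => (h φ a Fin.elim0).trans (h' φ Fin.elim0 b)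

/-- A subfield whose elements form an elementary substructure satisfies the same sentences. -/
theorem orderedFieldEquiv_of_elementarySubstructure {M : Type*} [Field M] [LinearOrder M]
    (F : Subfield M) (h : letI := Language.orderedRingStructure M
      ∃ S : Language.orderedRing.ElementarySubstructure M, (S : Set M) = F) :
    OrderedFieldEquiv M F := by
  let := Language.orderedRingStructure M
  let := Language.orderedRingStructure F
  obtain ⟨S, hS⟩ := h
  have hmem : ∀ x, x ∈ S ↔ x ∈ F := fun x => Set.ext_iff.1 hS x
  let e : F ≃[Language.orderedRing] S :=
    { toFun := fun x => ⟨x, (hmem x).2 x.2⟩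
      invFun := fun x => ⟨x, (hmem x).1 x.2⟩
      left_inv := fun x => rfl
      right_inv := fun x => rfl
      map_fun' := by
        rintro n (f | f) x
        · cases f <;> rfl
        · cases f
      map_rel' := by
        rintro n (r | r) x
        · cases r
        · cases r; rfl }
  intro φ a b
  have h₁ := S.isElementary φ (e ∘ b)
  have h₂ := StrongHomClass.realize_formula e φ (v := b)
  rw [← h₂, ← h₁, Subsingleton.elim a]

open Filter in
/-- Łoś's theorem for ordered fields. -/
theorem orderedFieldEquiv_ultrapower (K : Type*) [Field K] [LinearOrder K] :
    OrderedFieldEquiv K (Ultrapower K) := by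
  let := Language.orderedRingStructure K
  let := Language.orderedRingStructure (Ultrapower K)
  -- Both sides are the same type of germs; only the interpretations of the symbols need to be
  -- compared, on representatives.
  let e : (hyperfilter ℕ : Filter ℕ).Product (fun _ => K) ≃[Language.orderedRing] Ultrapower K :=
    { toFun := fun x => x
      invFun := fun x => x
      left_inv := fun x => rfl
      right_inv := fun x => rfl
      map_fun' := by
        intro n f x
        obtain ⟨y, rfl⟩ : ∃ y : Fin n → ℕ → K, (fun i => Quotient.mk _ (y i)) = x :=
          ⟨fun i => (x i).out, funext fun i => Quotient.out_eq _⟩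
        refine (Ultraproduct.funMap_cast f y).trans ?_
        rcases f with f | f
        · cases f <;> rfl
        · cases f
      map_rel' := by
        intro n r x
        obtain ⟨y, rfl⟩ : ∃ y : Fin n → ℕ → K, (fun i => Quotient.mk _ (y i)) = x :=
          ⟨fun i => (x i).out, funext fun i => Quotient.out_eq _⟩
        rcases r with r | r
        · cases r
        · cases r
          exact (relMap_quotient_mk' (L := Language.orderedRing) _ (ps := Ultraproduct.setoidPrestructure (fun _ => K) _)
            (.inr orderRel.le : Language.orderedRing.Relations 2) y).symm }
  intro φ a b
  have h₁ := Ultraproduct.realize_formula_cast (M := fun _ : ℕ => K) (u := hyperfilter ℕ) φ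
    fun i _ => a i
  rw [Filter.eventually_const] at h₁
  have h₂ := StrongHomClass.realize_formula e φ (v := e.symm ∘ b)
  rw [Subsingleton.elim (e ∘ e.symm ∘ b) b] at h₂
  rw [Subsingleton.elim (e.symm ∘ b)] at h₂
  exact h₁.symm.trans h₂.symm

/-! ### Countable elementary subfields with isomorphic residue and value groups -/

/-- `O` is a convex subring of `K`, `f` induces an isomorphism from the residue field of `O` onto
its value group, and `g` induces an injection of `K` into the residue field. -/
structure IsResidueValueData {K : Type*} [Field K] [LinearOrder K] (O : K → Prop) (f g : K → K) :
    Prop where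
  one : O 1
  neg : ∀ x, O x → O (-x)
  add : ∀ x y, O x → O y → O (x + y)
  mul : ∀ x y, O x → O y → O (x * y)
  convex : ∀ x y z, O x → O y → x ≤ z → z ≤ y → O z
  map_ne_zero : ∀ x, O x → f x ≠ 0
  map_add : ∀ x y, O x → O y → ∃ u v, O u ∧ O v ∧ u * v = 1 ∧ f (x + y) = u * (f x * f y)
  map_le_map : ∀ x y, O x → O y →
    ((∃ z, O z ∧ f y = z * f x) ↔ x ≤ y ∨ ∀ w, O w → w * (x + -y) ≠ 1)
  surjective : ∀ z, z ≠ 0 → ∃ x u v, O x ∧ O u ∧ O v ∧ u * v = 1 ∧ z = u * f x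
  mem : ∀ x, O (g x)
  injective : ∀ x y, (∀ w, O w → w * (g x + -g y) ≠ 1) → x = y

section Countable

variable {M : Type u} [Field M] [LinearOrder M] [IsStrictOrderedRing M] (O : ConvexSubring M)

open ConvexSubring

theorem ConvexSubring.exists_countable_subfield (hk : IsEtaOne O.ResidueField)
    (hΓ : IsEtaOne O.ValueGroup) (hdiv : IsDivisible O.ValueGroup) :
    ∃ (F : Subfield M) (R : AddSubgroup (O.ResidueField × O.ValueGroup)),
      Countable F ∧ OrderedFieldEquiv M F ∧ IsOrderGraph R ∧
      (∀ x : O.toValuationSubring, (x : M) ∈ F → ∃ y : Mˣ, (y : M) ∈ F ∧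
        (O.residue x, O.val y) ∈ R) ∧
      ∀ y : Mˣ, (y : M) ∈ F → ∃ x : O.toValuationSubring, (x : M) ∈ F ∧
        (O.residue x, O.val y) ∈ R := by
  let _ := Language.orderedRingStructure M
  let P := {R : AddSubgroup (O.ResidueField × O.ValueGroup) //
    IsOrderGraph R ∧ (R : Set (O.ResidueField × O.ValueGroup)).Countable}
  have hstep : ∀ (p : P) (s : Set M), ∃ q : P, p.1 ≤ q.1 ∧ (s.Countable →
      (∀ x : O.toValuationSubring, (x : M) ∈ s → ∃ h, (O.residue x, h) ∈ q.1) ∧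
      ∀ y : Mˣ, (y : M) ∈ s → ∃ g, (g, O.val y) ∈ q.1) := by
    intro p s
    -- The uncountable case never arises in the construction; it only makes `step` a total function.
    by_cases hs : s.Countable
    · obtain ⟨R, h₁, h₂, h₃, h₄, h₅⟩ := p.2.1.exists_extend_both O.isDivisible_residueField hk hdiv
        hΓ p.2.2 (X := O.residue '' (Subtype.val ⁻¹' s)) (Y := O.val '' (Units.val ⁻¹' s))
        ((hs.preimage Subtype.val_injective).image _) ((hs.preimage Units.val_injective).image _)
      exact ⟨⟨R, h₂, h₃⟩, h₁, fun _ => ⟨fun x hx => h₄ _ ⟨x, hx, rfl⟩, fun y hy => h₅ _ ⟨y, hy, rfl⟩⟩⟩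
    · exact ⟨p, le_rfl, fun h => absurd h hs⟩
  choose step hle hcov using hstep
  choose rep hrep using O.residue_surjective
  choose unit hunit using O.val_surjective
  -- Representatives of both coordinates of every matched pair are adjoined. Inverses are added
  -- because the language has no symbol for them, while the union must be a subfield.
  let gen : P → Set M → Set M := fun p s =>
    (fun q : O.ResidueField × O.ValueGroup => (rep q.1 : M)) '' p.1 ∪
      ((fun q : O.ResidueField × O.ValueGroup => (unit q.2 : M)) '' p.1 ∪ (fun x => x⁻¹) '' s)
  have hgen : ∀ p s, s.Countable → (gen p s).Countable := fun p s hs =>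
    (p.2.2.image _).union ((p.2.2.image _).union (hs.image _))
  obtain ⟨S, p, s, hmono, hc, hS, -, hp, hs⟩ := exists_elementarySubstructure_of_step
    Language.orderedRing step gen hgen
    ⟨⊥, IsOrderGraph.bot, by simp⟩
  have hpm : Monotone fun n => (p n).1 := monotone_nat_of_le_succ fun n => by
    rw [hp]
    exact hle _ _
  have hmem : ∀ x, x ∈ S ↔ ∃ n, x ∈ s n := fun x => by
    rw [← SetLike.mem_coe, hS, Set.mem_iUnion]
  let F : Subfield M :=
    { carrier := S
      mul_mem' := fun {x y} hx hy => S.toSubstructure.fun_mem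
        (.inl Ring.mulFunc : Language.orderedRing.Functions 2) ![x, y]
          (Fin.forall_fin_two.2 ⟨hx, hy⟩)
      add_mem' := fun {x y} hx hy => S.toSubstructure.fun_mem
        (.inl Ring.addFunc : Language.orderedRing.Functions 2) ![x, y]
          (Fin.forall_fin_two.2 ⟨hx, hy⟩)
      neg_mem' := fun {x} hx => S.toSubstructure.fun_mem
        (.inl Ring.negFunc : Language.orderedRing.Functions 1) ![x] (Fin.forall_fin_one.2 hx)
      zero_mem' := S.toSubstructure.fun_mem
        (.inl Ring.zeroFunc : Language.orderedRing.Functions 0) ![] finZeroElim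
      one_mem' := S.toSubstructure.fun_mem
        (.inl Ring.oneFunc : Language.orderedRing.Functions 0) ![] finZeroElim
      inv_mem' := fun x hx => by
        obtain ⟨n, hn⟩ := (hmem x).1 hx
        exact (hmem _).2 ⟨n + 1, hs n (Or.inr (Or.inr ⟨x, hn, rfl⟩))⟩ }
  have hFS : ∀ x, x ∈ F ↔ ∃ n, x ∈ s n := hmem
  have hR : ∀ n, (p n).1 ≤ ⨆ n, (p n).1 := le_iSup fun n => (p n).1
  refine ⟨F, ⨆ n, (p n).1, ?_, orderedFieldEquiv_of_elementarySubstructure F ⟨S, rfl⟩,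
    IsOrderGraph.iSup hpm fun n => (p n).2.1, fun x hx => ?_, fun y hy => ?_⟩
  · have : (F : Set M).Countable := by
      change (S : Set M).Countable
      rw [hS]
      exact Set.countable_iUnion hc
    exact this.to_subtype
  · obtain ⟨n, hn⟩ := (hFS _).1 hx
    -- An element present at stage `n` is matched by the graph of stage `n + 1`, and its partner has
    -- a representative adjoined at that stage.
    obtain ⟨h, hh⟩ := (hcov (p n) (s n) (hc n)).1 x hn
    rw [← hp] at hh
    refine ⟨unit h, (hFS _).2 ⟨n + 1, hs n (Or.inr (Or.inl ⟨_, hh, rfl⟩))⟩, ?_⟩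
    rw [hunit]
    exact hR _ hh
  · obtain ⟨n, hn⟩ := (hFS _).1 hy
    obtain ⟨g, hg⟩ := (hcov (p n) (s n) (hc n)).2 y hn
    rw [← hp] at hg
    refine ⟨rep g, (hFS _).2 ⟨n + 1, hs n (Or.inl ⟨_, hg, rfl⟩)⟩, ?_⟩
    rw [hrep]
    exact hR _ hg

/-- A countable subfield on which an order graph between the residue field and the value group of
`O` is total and onto carries data as in `IsResidueValueData`. -/
theorem ConvexSubring.exists_isResidueValueData (F : Subfield M)
    (R : AddSubgroup (O.ResidueField × O.ValueGroup)) [Countable F] (hR : IsOrderGraph R)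
    (h₁ : ∀ x : O.toValuationSubring, (x : M) ∈ F → ∃ y : Mˣ, (y : M) ∈ F ∧
      (O.residue x, O.val y) ∈ R)
    (h₂ : ∀ y : Mˣ, (y : M) ∈ F → ∃ x : O.toValuationSubring, (x : M) ∈ F ∧
      (O.residue x, O.val y) ∈ R) :
    ∃ (P : F → Prop) (f g : F → F), IsResidueValueData P f g := by
  let P : F → Prop := fun x => (x : M) ∈ O.toSubring
  have hf : ∀ x : F, ∀ hx : P x, ∃ y : F, ∃ hy : (y : M) ≠ 0,
      (O.residue ⟨x, hx⟩, O.val (Units.mk0 y hy)) ∈ R := by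
    intro x hx
    obtain ⟨y, hy, hxy⟩ := h₁ ⟨x, hx⟩ x.2
    refine ⟨⟨y, hy⟩, y.ne_zero, ?_⟩
    rwa [show Units.mk0 (y : M) y.ne_zero = y from Units.ext rfl]
  choose! f hf₀ hfR using hf
  obtain ⟨e, he⟩ := exists_injective_nat F
  have hval : ∀ a b : F, ∀ (ha : (a : M) ≠ 0) (hb : (b : M) ≠ 0),
      O.val (Units.mk0 a ha) = O.val (Units.mk0 b hb) →
      ∃ u v, P u ∧ P v ∧ u * v = 1 ∧ a = u * b := by
    intro a b ha hb h
    have ha' : a ≠ 0 := fun h => ha (by rw [h]; rfl)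
    have hb' : b ≠ 0 := fun h => hb (by rw [h]; rfl)
    refine ⟨a / b, b / a, (O.val_le_val _ _).1 h.ge, (O.val_le_val _ _).1 h.le, ?_, ?_⟩
    · field_simp
    · field_simp
  -- Quantifying over `F` instead of `M` changes nothing, since the only possible witness is `d⁻¹`,
  -- which lies in `F`.
  have hinf : ∀ d : F, (∀ w ∈ O.toSubring, w * (d : M) ≠ 1) ↔ ∀ w, P w → w * d ≠ 1 := by
    refine fun d => ⟨fun h w hw hwd => h w hw (congrArg Subtype.val hwd), fun h w hw hwd => ?_⟩
    have hw' : w = ((d⁻¹ : F) : M) := eq_inv_of_mul_eq_one_left hwd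
    refine h d⁻¹ (show ((d⁻¹ : F) : M) ∈ O.toSubring from hw' ▸ hw) (Subtype.ext ?_)
    change ((d⁻¹ : F) : M) * d = 1
    rw [← hw', hwd]
  refine ⟨P, f, fun x => (e x : F), ?_⟩
  constructor
  case one => exact O.toSubring.one_mem
  case neg => exact fun x hx => O.toSubring.neg_mem hx
  case add => exact fun x y hx hy => O.toSubring.add_mem hx hy
  case mul => exact fun x y hx hy => O.toSubring.mul_mem hx hy
  case convex => exact fun x y z hx hy hxz hzy => O.ordConnected'.out hx hy ⟨hxz, hzy⟩
  case map_ne_zero => exact fun x hx h => hf₀ x hx (by rw [h]; rfl)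
  case map_add =>
    intro x y hx hy
    have hxy : P (x + y) := O.toSubring.add_mem hx hy
    have hne : ((f x * f y : F) : M) ≠ 0 := mul_ne_zero (hf₀ x hx) (hf₀ y hy)
    refine hval (f (x + y)) (f x * f y) (hf₀ _ hxy) hne ?_
    have := hR.fst_eq_iff (hfR _ hxy) (R.add_mem (hfR x hx) (hfR y hy))
    rw [Prod.mk_add_mk, ← O.val_mul, ← map_add] at this
    refine (this.1 rfl).trans (congrArg O.val (Units.ext rfl))
  case map_le_map =>
    intro x y hx hy
    have h₃ : (x : M) ≤ y ∨ (∀ w ∈ O.toSubring, w * (x - y : M) ≠ 1) ↔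
        x ≤ y ∨ ∀ w, P w → w * (x + -y) ≠ 1 := by
      rw [← hinf, ← sub_eq_add_neg]
      rfl
    rw [← h₃]
    refine Iff.trans ?_ (O.residue_le_residue_iff (x := ⟨x, hx⟩) (y := ⟨y, hy⟩))
    rw [hR.fst_le_iff (hfR x hx) (hfR y hy), O.val_le_val]
    have hx0 : f x ≠ 0 := fun h => hf₀ x hx (by rw [h]; rfl)
    constructor
    · rintro ⟨z, hz, h⟩
      have : z = f y / f x := by rw [h]; field_simp
      rw [this] at hz
      exact hz
    · exact fun h => ⟨f y / f x, h, by field_simp⟩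
  case surjective =>
    intro z hz
    have hz' : (z : M) ≠ 0 := fun h => hz (Subtype.ext h)
    obtain ⟨⟨x, hxO⟩, hxF, hxz⟩ := h₂ (Units.mk0 z hz') z.2
    have hx : P ⟨x, hxF⟩ := hxO
    obtain ⟨u, v, hu, hv, huv, h⟩ := hval z (f ⟨x, hxF⟩) hz' (hf₀ _ hx)
      ((hR.fst_eq_iff hxz (hfR _ hx)).1 rfl)
    exact ⟨⟨x, hxF⟩, u, v, hx, hu, hv, huv, h⟩
  case mem => exact fun x => by simp [P]
  case injective =>
    intro x y h
    by_contra hxy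
    -- Distinct natural numbers have distinct residues: their difference is a nonzero integer, whose
    -- inverse lies in $[-1,1]\subseteq O$.
    have hne : (e x : ℤ) - e y ≠ 0 := sub_ne_zero.2 (by exact_mod_cast he.ne hxy)
    set m : ℤ := e x - e y with hm
    have hcast : ((e x : F) + -(e y : F)) = (m : F) := by rw [hm]; push_cast; ring
    rw [hcast] at h
    have hm0 : (m : F) ≠ 0 := Int.cast_ne_zero.2 hne
    refine h (m : F)⁻¹ ?_ (inv_mul_cancel₀ hm0)
    have h1 : |(m : M)⁻¹| ≤ 1 := by
      rw [abs_inv]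
      exact inv_le_one_of_one_le₀ (by exact_mod_cast Int.one_le_abs hne)
    have : (m : M)⁻¹ ∈ O.toSubring := O.ordConnected'.out (O.toSubring.neg_mem O.toSubring.one_mem)
      O.toSubring.one_mem (abs_le.1 h1)
    simpa [P] using! this

end Countable

/-! ### The first-order theory of residue-value data -/

theorem FirstOrder.Language.IsRecursive.of_finite {L : FirstOrder.Language.{0, 0}} [Finite L.Symbols] {k : ℕ}
    {T : Set (L.Formula (Fin k))} (hT : T.Finite) : IsRecursive T := by
  obtain ⟨c, hc⟩ := exists_injective_nat L.Symbols
  refine ⟨c, hc, ?_⟩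
  have hfin : {m : ℕ | ∃ φ ∈ T, formulaCode c φ = m}.Finite := hT.image (formulaCode c)
  have : ∀ s : Finset ℕ, ComputablePred (· ∈ s) := by
    intro s
    refine PrimrecPred.computablePred ?_
    induction s using Finset.induction_on with
    | empty => exact (Primrec.primrecPred (p := (· ∈ (∅ : Finset ℕ)))
        ((Primrec.const false).of_eq fun _ => by simp))
    | insert a s _ ih =>
      exact ((Primrec.eq.comp Primrec.id (Primrec.const a)).or ih).of_eq fun n => by simp
  simpa using! this hfin.toFinset

namespace ResidueValue

/-- Two unary function symbols. -/
inductive Func : ℕ → Type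
  | iso : Func 1
  | inj : Func 1

/-- One unary relation symbol. -/
inductive Rel : ℕ → Type
  | mem : Rel 1

/-- The language with a unary relation symbol for a convex subring and two unary function symbols,
for an isomorphism of its residue field with its value group and for an injection into its residue
field. -/
def lang : FirstOrder.Language.{0, 0} := ⟨Func, Rel⟩

instance : Finite lang.Symbols := by
  have h₁ : Finite (Σ l, lang.Functions l) :=
    Finite.of_surjective (fun b : Bool => if b then ⟨1, Func.iso⟩ else ⟨1, Func.inj⟩) (by
      rintro ⟨_, _ | _⟩
      · exact ⟨true, rfl⟩
      · exact ⟨false, rfl⟩)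
  have h₂ : Finite (Σ l, lang.Relations l) :=
    Finite.of_surjective (fun _ : Unit => ⟨1, Rel.mem⟩) (by
      rintro ⟨_, ⟨⟩⟩
      exact ⟨(), rfl⟩)
  exact inferInstanceAs (Finite (_ ⊕ _))

instance finite_symbols_sum (L L' : FirstOrder.Language.{0, 0}) [Finite L.Symbols]
    [Finite L'.Symbols] : Finite (L.sum L').Symbols := by
  refine Cardinal.mk_lt_aleph0_iff.1 ?_
  change (L.sum L').card < _
  rw [card_sum, Cardinal.lift_id, Cardinal.lift_id]
  exact Cardinal.add_lt_aleph0 (Cardinal.mk_lt_aleph0_iff.2 ‹Finite L.Symbols›)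
    (Cardinal.mk_lt_aleph0_iff.2 ‹Finite L'.Symbols›)

/-- The language of ordered rings with the symbols of `lang`. -/
abbrev ext : FirstOrder.Language.{0, 0} := Language.orderedRing.sum lang

section Terms

variable {α : Type} (s t : ext.Term α)

/-- The sum of two terms. -/
def add : ext.Term α :=
  Functions.apply₂ (.inl (.inl Ring.addFunc) : ext.Functions 2) s t

/-- The product of two terms. -/
def mul : ext.Term α :=
  Functions.apply₂ (.inl (.inl Ring.mulFunc) : ext.Functions 2) s t

/-- The negative of a term. -/
def neg : ext.Term α :=
  Functions.apply₁ (.inl (.inl Ring.negFunc) : ext.Functions 1) s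

/-- The term `0`. -/
def zero : ext.Term α :=
  Constants.term (.inl (.inl Ring.zeroFunc) : ext.Constants)

/-- The term `1`. -/
def one : ext.Term α :=
  Constants.term (.inl (.inl Ring.oneFunc) : ext.Constants)

/-- The function symbol for the isomorphism applied to a term. -/
def iso : ext.Term α :=
  Functions.apply₁ (.inr Func.iso : ext.Functions 1) s

/-- The function symbol for the injection applied to a term. -/
def inj : ext.Term α :=
  Functions.apply₁ (.inr Func.inj : ext.Functions 1) s

variable {n : ℕ} (p q : ext.Term (α ⊕ Fin n))

/-- The formula `p ≤ q`. -/
def le : ext.BoundedFormula α n :=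
  Relations.boundedFormula₂ (.inl (.inr orderRel.le) : ext.Relations 2) p q

/-- The formula `p ∈ O`. -/
def mem : ext.BoundedFormula α n :=
  Relations.boundedFormula₁ (.inr Rel.mem : ext.Relations 1) p

end Terms

/-- Formulas that express data as in `IsResidueValueData`. -/
def formulas : Set (ext.Formula (Fin 0)) :=
  {mem one,
   ∀' ((mem &0).imp (mem (neg &0))),
   ∀' ∀' ((mem &0).imp ((mem &1).imp (mem (add &0 &1)))),
   ∀' ∀' ((mem &0).imp ((mem &1).imp (mem (mul &0 &1)))),
   ∀' ∀' ∀' ((mem &0).imp ((mem &1).imp ((le &0 &2).imp ((le &2 &1).imp (mem &2))))),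
   ∀' ((mem &0).imp ∼(iso &0 =' zero)),
   ∀' ∀' ((mem &0).imp ((mem &1).imp (∃' ∃' (mem &2 ⊓ (mem &3 ⊓ ((mul &2 &3 =' one) ⊓
      (iso (add &0 &1) =' mul &2 (mul (iso &0) (iso &1))))))))),
   ∀' ∀' ((mem &0).imp ((mem &1).imp ((∃' (mem &2 ⊓ (iso &1 =' mul &2 (iso &0)))).iff
      (le &0 &1 ⊔ ∀' ((mem &2).imp ∼(mul &2 (add &0 (neg &1)) =' one)))))),
   ∀' (∼(&0 =' zero) ⟹ ∃' ∃' ∃' (mem &1 ⊓ (mem &2 ⊓ (mem &3 ⊓ ((mul &2 &3 =' one) ⊓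
      (&0 =' mul &2 (iso &1))))))),
   ∀' mem (inj &0),
   ∀' ∀' ((∀' ((mem &2).imp ∼(mul &2 (add (inj &0) (neg (inj &1))) =' one))).imp (&0 =' &1))}

theorem finite_formulas : formulas.Finite := by
  simp [formulas]

section Realize

variable {K : Type*} [Field K] [LinearOrder K] [lang.Structure K]

attribute [local instance] Language.orderedRingStructure

variable {α : Type} (s t : ext.Term α) (v : α → K)

theorem realize_add : (add s t).realize v = s.realize v + t.realize v :=
  Term.realize_functions_apply₂

theorem realize_mul : (mul s t).realize v = s.realize v * t.realize v :=
  Term.realize_functions_apply₂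

theorem realize_neg : (neg s).realize v = -s.realize v :=
  Term.realize_functions_apply₁

theorem realize_zero : (zero : ext.Term α).realize v = 0 :=
  Term.realize_constants

theorem realize_one : (one : ext.Term α).realize v = 1 :=
  Term.realize_constants

theorem realize_iso : (iso s).realize v =
    Structure.funMap (L := lang) Func.iso ![s.realize v] :=
  Term.realize_functions_apply₁

theorem realize_inj : (inj s).realize v =
    Structure.funMap (L := lang) Func.inj ![s.realize v] :=
  Term.realize_functions_apply₁

variable {n : ℕ} (p q : ext.Term (α ⊕ Fin n)) (w : Fin n → K)

theorem realize_le : (le p q).Realize v w ↔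
    p.realize (Sum.elim v w) ≤ q.realize (Sum.elim v w) :=
  BoundedFormula.realize_rel₂

theorem realize_mem : (mem p).Realize v w ↔
    Structure.RelMap (L := lang) Rel.mem ![p.realize (Sum.elim v w)] :=
  BoundedFormula.realize_rel₁

/-- The formulas follow the order of the structure fields and unfold to them definitionally, so only
repackaging is left after `simp`. -/
theorem realize_formulas_iff (a : Fin 0 → K) : (∀ φ ∈ formulas, φ.Realize a) ↔
    IsResidueValueData (fun x : K => Structure.RelMap (L := lang) Rel.mem ![x])
      (fun x => Structure.funMap (L := lang) Func.iso ![x])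
      (fun x => Structure.funMap (L := lang) Func.inj ![x]) := by
  simp only [formulas, Set.mem_insert_iff, Set.mem_singleton_iff, forall_eq_or_imp, forall_eq,
    Formula.Realize, BoundedFormula.realize_all, BoundedFormula.realize_ex,
    BoundedFormula.realize_imp, BoundedFormula.realize_inf, BoundedFormula.realize_sup,
    BoundedFormula.realize_iff, BoundedFormula.realize_not, BoundedFormula.realize_bdEqual,
    realize_add, realize_mul, realize_neg, realize_zero, realize_one, realize_iso, realize_inj,
    realize_le, realize_mem]
  constructor
  · rintro ⟨h₁, h₂, h₃, h₄, h₅, h₆, h₇, h₈, h₉, h₁₀, h₁₁⟩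
    exact ⟨h₁, h₂, h₃, h₄, h₅, h₆, h₇, h₈, h₉, h₁₀, h₁₁⟩
  · rintro ⟨h₁, h₂, h₃, h₄, h₅, h₆, h₇, h₈, h₉, h₁₀, h₁₁⟩
    exact ⟨h₁, h₂, h₃, h₄, h₅, h₆, h₇, h₈, h₉, h₁₀, h₁₁⟩

end Realize

end ResidueValue

namespace ResidueValue

/-- The interpretation of the symbols of `lang` by a predicate and two functions. -/
abbrev toStructure {K : Type*} (P : K → Prop) (f g : K → K) : lang.Structure K where
  funMap
    | Func.iso, x => f (x 0)
    | Func.inj, x => g (x 0)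
  RelMap
    | Rel.mem, x => P (x 0)

/-- The field `F`, expanded by the given data, is itself a model; with no free variables, elementary
equivalence takes care of the theory of `K`. -/
theorem isSatisfiable {K F : Type*} [Field K] [LinearOrder K] [Field F] [LinearOrder F]
    (hKF : OrderedFieldEquiv K F) {P : F → Prop} {f g : F → F} (h : IsResidueValueData P f g)
    (a : Fin 0 → K) :
    let _ := Language.orderedRingStructure K
    Theory.IsSatisfiable
      (Formula.equivSentence '' (formulas ∪ Language.orderedRing.pointTheory lang a)) := by
  let _ := Language.orderedRingStructure K
  let _ := Language.orderedRingStructure F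
  let _ := toStructure P f g
  let _ := constantsOn.structure (Fin.elim0 : Fin 0 → F)
  have : F ⊨ (Formula.equivSentence '' (formulas ∪ Language.orderedRing.pointTheory lang a) :
      Theory _) := by
    refine ⟨?_⟩
    rintro _ ⟨φ, hφ, rfl⟩
    refine (Formula.realize_equivSentence F φ).2 ?_
    rcases hφ with hφ | ⟨ψ, hψ, rfl⟩
    · exact (realize_formulas_iff _).2 h φ hφ
    · rw [LHom.realize_onFormula]
      exact (hKF ψ a _).1 hψ
  exact Theory.Model.isSatisfiable F

end ResidueValue

/-! ### Transfer to resplendent fields and the standard value group -/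

section

variable {K : Type u} [Field K] [LinearOrder K] [IsStrictOrderedRing K]

/-- A resplendent ordered field with roots of nonnegative elements carries residue-value data. -/
theorem IsResplendentField.exists_isResidueValueData (hK : IsResplendentField K)
    (hroot : ∀ n : ℕ, n ≠ 0 → ∀ x : K, 0 ≤ x → ∃ r, x = r ^ n) :
    ∃ (P : K → Prop) (f g : K → K), IsResidueValueData P f g := by
  obtain ⟨x, hx⟩ := Ultrapower.exists_not_mem_finite (K := K)
  -- Two ultrapowers are taken: the first makes `O₁` proper, hence the later value group nontrivial;
  -- the second makes the subring internal, so that saturation applies.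
  set O₁ := ConvexSubring.finite (Ultrapower K)
  have hdiv := O₁.ultrapower.isDivisible_valueGroup
    (Ultrapower.exists_eq_pow (Ultrapower.exists_eq_pow hroot))
  have := O₁.ultrapower.nontrivial_valueGroup (Ultrapower.const_not_mem_ultrapower hx)
  obtain ⟨F, R, hF, hMF, hR, h₁, h₂⟩ := O₁.ultrapower.exists_countable_subfield
    O₁.isEtaOne_residueField (O₁.isEtaOne_valueGroup hdiv) hdiv
  obtain ⟨P, f, g, h⟩ := O₁.ultrapower.exists_isResidueValueData F R hR h₁ h₂
  have hKF := ((orderedFieldEquiv_ultrapower K).trans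
    (orderedFieldEquiv_ultrapower (Ultrapower K))).trans hMF
  obtain ⟨_, hs⟩ := hK ResidueValue.lang 0 ResidueValue.formulas Fin.elim0
    (.of_finite ResidueValue.finite_formulas) (ResidueValue.isSatisfiable hKF h Fin.elim0)
  exact ⟨_, _, _, (ResidueValue.realize_formulas_iff _).1 hs⟩

theorem IsResidueValueData.exists_convexSubring {P : K → Prop} {f g : K → K}
    (h : IsResidueValueData P f g) :
    ∃ O : ConvexSubring K, Cardinal.mk O.ResidueField = Cardinal.mk K ∧
      Nonempty (O.ResidueField ≃+o O.ValueGroup) := by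
  let O : ConvexSubring K :=
    { carrier := {x | P x}
      zero_mem' := by simpa using! h.add _ _ h.one (h.neg _ h.one)
      one_mem' := h.one
      add_mem' := fun {x y} hx hy => h.add x y hx hy
      mul_mem' := fun {x y} hx hy => h.mul x y hx hy
      neg_mem' := fun {x} hx => h.neg x hx
      ordConnected' := ⟨fun x hx y hy z hz => h.convex x y z hx hy hz.1 hz.2⟩ }
  have hO : ∀ x, x ∈ O.toSubring ↔ P x := fun x => Iff.rfl
  refine ⟨O, le_antisymm ?_ ?_, ?_⟩
  · exact (Cardinal.mk_le_of_surjective O.residue_surjective).trans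
      (Cardinal.mk_le_of_injective (f := Subtype.val) Subtype.val_injective)
  · refine Cardinal.mk_le_of_injective (f := fun x => O.residue ⟨g x, h.mem x⟩) fun x y hxy => ?_
    refine h.injective x y ?_
    rw [← sub_eq_add_neg]
    exact O.residue_eq_iff.1 hxy
  -- `F` is defined on `O` itself and descends to an isomorphism on residues, since it identifies
  -- exactly the elements with equal residue.
  let F : O.toValuationSubring → O.ValueGroup := fun x =>
    O.val (Units.mk0 (f x) (h.map_ne_zero x x.2))
  have hle : ∀ x y, F x ≤ F y ↔ O.residue x ≤ O.residue y := by
    intro x y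
    rw [O.residue_le_residue_iff, O.val_le_val, sub_eq_add_neg]
    refine Iff.trans ?_ (h.map_le_map x y x.2 y.2)
    have hx := h.map_ne_zero x x.2
    constructor
    · exact fun h => ⟨f y / f x, h, by field_simp⟩
    · rintro ⟨z, hz, hzx⟩
      rw [hO, Units.val_mk0, Units.val_mk0, hzx, mul_div_cancel_right₀ _ hx]
      exact hz
  have heq : ∀ x y, F x = F y ↔ O.residue x = O.residue y := fun x y => by
    rw [le_antisymm_iff, le_antisymm_iff, hle, hle]
  -- The axioms express equality of values by a factor `u` in `O` with inverse `v` in `O`.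
  have hval : ∀ (a b : Kˣ) (u v : K), P u → P v → u * v = 1 → (a : K) = u * b →
      O.val a = O.val b := by
    intro a b u v hu hv huv hab
    have hu0 : u ≠ 0 := left_ne_zero_of_mul_eq_one huv
    apply le_antisymm <;> rw [O.val_le_val, hab, hO]
    · rwa [div_mul_cancel_right₀ b.ne_zero, ← eq_inv_of_mul_eq_one_right huv]
    · rwa [mul_div_cancel_right₀ _ b.ne_zero]
  have hadd : ∀ x y, F (x + y) = F x + F y := by
    intro x y
    obtain ⟨u, v, hu, hv, huv, hxy⟩ := h.map_add x y x.2 y.2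
    rw [← O.val_mul]
    exact hval _ _ u v hu hv huv hxy
  have hsurj : Function.Surjective F := by
    intro q
    obtain ⟨z, rfl⟩ := O.val_surjective q
    obtain ⟨x, u, v, hx, hu, hv, huv, hz⟩ := h.surjective z z.ne_zero
    exact ⟨⟨x, hx⟩, (hval _ _ u v hu hv huv hz).symm⟩
  choose rep hrep using O.residue_surjective
  have hF : ∀ x, F (rep (O.residue x)) = F x := fun x => (heq _ _).2 (hrep _)
  let e : O.ResidueField →+ O.ValueGroup := AddMonoidHom.mk' (fun q => F (rep q)) fun p q => by
    rw [← hadd, heq, _root_.map_add, hrep, hrep, hrep]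
  have he : Function.Bijective e := by
    constructor
    · intro p q hpq
      rw [← hrep p, ← hrep q]
      exact (heq _ _).1 hpq
    · intro q
      obtain ⟨x, rfl⟩ := hsurj q
      exact ⟨O.residue x, hF x⟩
  exact ⟨{ AddEquiv.ofBijective e he with
    map_le_map_iff' := fun {p q} => (hle _ _).trans (by rw [hrep, hrep]) }⟩

/-- Every subring contains the integers, so convexity forces all finite elements in. Thus $v_O$ is
coarser than the standard valuation. -/
theorem ConvexSubring.finite_le (O : ConvexSubring K) {x : K}
    (hx : x ∈ (ConvexSubring.finite K).toSubring) : x ∈ O.toSubring := by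
  obtain ⟨n, hn⟩ := hx
  have h : (n : K) ∈ O.toSubring := natCast_mem _ n
  exact O.ordConnected'.out (O.toSubring.neg_mem h) h (abs_le.1 hn)

/-- If the residue field and the value group of a convex subring are isomorphic, the standard value
group has an interval at least as large as the residue field. -/
theorem ConvexSubring.exists_mk_residueField_le (O : ConvexSubring K)
    (e : O.ResidueField ≃+o O.ValueGroup) : ∃ a b : StandardValueGroup K,
      Cardinal.mk O.ResidueField ≤ Cardinal.mk (Set.Icc a b) := by
  choose r hr using O.val_surjective
  let s : O.ResidueField → StandardValueGroup K := fun q => (ConvexSubring.finite K).val (r (e q))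
  have hs : StrictMono s := by
    intro p q hpq
    have : O.val (r (e p)) < O.val (r (e q)) := by
      rw [hr, hr]
      exact lt_of_le_not_ge ((map_le_map_iff e).2 hpq.le) fun h =>
        hpq.not_ge ((map_le_map_iff e).1 h)
    rw [val_lt_val] at this
    exact (val_lt_val _ _ _).2 fun h => this (O.finite_le h)
  -- Squeezing the residue field into its own interval $(-1,1)$ bounds the image of `s` without
  -- losing cardinality.
  let i := orderIsoIooNegOneOne O.ResidueField
  refine ⟨s (-1), s 1, Cardinal.mk_le_of_injective
    (f := fun q => ⟨s (i q), hs.monotone (i q).2.1.le, hs.monotone (i q).2.2.le⟩) fun p q hpq => ?_⟩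
  exact i.injective (Subtype.ext (hs.injective (congrArg Subtype.val hpq)))

end

theorem proposition2p2 {K : Type u} [Field K] [LinearOrder K] [IsStrictOrderedRing K]
    [IsRealClosed K] (hK : IsResplendentField K) :
    (∃ O : ConvexSubring K, Cardinal.mk O.ResidueField = Cardinal.mk K ∧
      Nonempty (O.ResidueField ≃+o O.ValueGroup)) ∧
    ∃ a b : StandardValueGroup K, Cardinal.mk (Set.Icc a b) = Cardinal.mk K := by
  -- Real closedness enters only through the existence of roots of nonnegative elements.
  obtain ⟨P, f, g, h⟩ := hK.exists_isResidueValueData fun n hn x hx =>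
    IsRealClosed.exists_eq_pow_of_nonneg hx hn
  obtain ⟨O, hcard, ⟨e⟩⟩ := h.exists_convexSubring
  obtain ⟨a, b, hab⟩ := O.exists_mk_residueField_le e
  refine ⟨⟨O, hcard, ⟨e⟩⟩, a, b, le_antisymm ?_ (hcard ▸ hab)⟩
  exact (Cardinal.mk_subtype_le _).trans
    ((Cardinal.mk_le_of_surjective (ConvexSubring.finite K).val_surjective).trans
      (Cardinal.mk_le_of_injective (f := Units.val) Units.val_injective))
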